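/- Consider the constrained uncertain linear system $x_{k+1}=A_kx_k+B_ku_k+w_k$ with $x_k\in\mathbb X\subseteq\mathbb R^{n_x}$, $u_k\in\mathbb U\subseteq\mathbb R^{n_u}$ and unknown $(A_k,B_k,w_k)\in\mathbb D$. Assume that $\mathbb X$ and $\mathbb U$ are closed and convex with $0\in\mathbb X$ and $0\in\mathbb U$; that $\mathbb D\subseteq\mathbb R^{n_x\times n_x}\times\mathbb R^{n_x\times n_u}\times\mathbb R^{n_x}$ is non-empty, compact and convex; and that some $(A,B,w)\in\mathbb D$ has $\operatorname{rank}(B)=n_u$ (in particular, this holds if every input matrix occurring in $\mathbb D$ has full column rank). Let $X_{\mathrm s}\subseteq\mathbb X$ be a compact convex robust control invariant (RCI) set, i.e. for every $x\in X_{\mathrm s}$ there is $u\in\mathbb U$ with $Ax+Bu+w\in X_{\mathrm s}$ for all $(A,B,w)\in\mathbb D$. Let $L:\mathbb R^{n_x}\times\mathbb R^{n_u}\to[0,\infty)$ be convex and positive semi-definite with respect to $X_{\mathrm s}$: for every $x\in X_{\mathrm s}$ there is $u\in\mathbb U$ such that $L(x,u)=0$ and $Ax+Bu+w\in X_{\mathrm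 s}$ for all $(A,B,w)\in\mathbb D$. Let $\lambda\in[0,1)$ and let $X\subseteq\mathbb X$ be a compact convex set with $X_{\mathrm s}\subseteq X$ that is robust $\lambda$-contractive relative to $X_{\mathrm s}$: for every $x\in X$ there is $u\in\mathbb U$ with $Ax+Bu+w\in\lambda X\oplus(1-\lambda)X_{\mathrm s}$ for all $(A,B,w)\in\mathbb D$, where $\oplus$ is the Minkowski sum. For a set $Y$ let $I_Y$ be $0$ on $Y$ and $+\infty$ off $Y$. A function $M:\mathbb R^{n_x}\to[0,\infty]$ is called a robust $L$-CLF if its domain $\operatorname{dom}(M)=\{x: M(x)<\infty\}$ is non-empty and compact, its epigraph $\{(x,y)\in\mathbb R^{n_x}\times\mathbb R: M(x)\le y\}$ is closed and convex, $M(x_{\mathrm s})=0$ for some $x_{\mathrm s}\in\mathbb X$, and, for all $x\in\mathbb R^{n_x}$, $$M(x)\ \ge\ \min_{u\in\mathbb U}\ \sup_{(A,B,w)\in\mathbb D}\ L(x,u)+I_{\mathbb X}(x)+M(Ax+Bu+w),$$ where the supremum is taken in $[0,\infty]$ and the minimum over $u$ is attained. Let $\widehat{\mathcal M}(X)$ be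 the set of robust $L$-CLFs $M$ with $\operatorname{dom}(M)=X$. Then, for every Borel probability measure $\mu$ with $\operatorname{supp}(\mu)=X$, the problem $$\min_{M\in\widehat{\mathcal M}(X)}\ \int_X M\,\mathrm d\mu$$ has a minimizer $M^\star\in\widehat{\mathcal M}(X)$, this minimizer is unique (as a function on $\mathbb R^{n_x}$), and it satisfies the min-max HJB equation $$M^\star(x)\ =\ \min_{u\in\mathbb U}\ \sup_{(A,B,w)\in\mathbb D}\ L(x,u)+I_X(x)+M^\star(Ax+Bu+w)\qquad\text{for all }x\in X,$$ with the minimum over $u$ attained. -/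

import Mathlib

open MeasureTheory
open scoped ENNReal Pointwise

/-- The data of a constrained uncertain linear system
`x⁺ = A x + B u + w`, `x ∈ 𝕏`, `u ∈ 𝕌`, `(A, B, w) ∈ 𝔻`, with `n` states and `m` controls. -/
structure UncertainSystem (n m : ℕ) where
  /-- the state constraint set `𝕏` -/
  stateSet : Set (Fin n → ℝ)
  /-- the control constraint set `𝕌` -/
  inputSet : Set (Fin m → ℝ)
  /-- the uncertainty set `𝔻` -/
  uncertainty : Set (Matrix (Fin n) (Fin n) ℝ × Matrix (Fin n) (Fin m) ℝ × (Fin n → ℝ))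

namespace UncertainSystem

variable {n m : ℕ}

/-- The successor state `A x + B u + w` for the uncertainty `d = (A, B, w)`. -/
def next (d : Matrix (Fin n) (Fin n) ℝ × Matrix (Fin n) (Fin m) ℝ × (Fin n → ℝ))
    (x : Fin n → ℝ) (u : Fin m → ℝ) : Fin n → ℝ :=
  d.1.mulVec x + d.2.1.mulVec u + d.2.2

/-- Standing assumptions: `𝕏` and `𝕌` are closed and convex and contain the origin, `𝔻` is
non-empty, compact and convex, and the input matrix has full column rank `m` (required of at
least one input matrix that occurs in `𝔻`, hence satisfied when all of them have full rank). -/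
structure StandingAssumptions (S : UncertainSystem n m) : Prop where
  isClosed_stateSet : IsClosed S.stateSet
  convex_stateSet : Convex ℝ S.stateSet
  zero_mem_stateSet : 0 ∈ S.stateSet
  isClosed_inputSet : IsClosed S.inputSet
  convex_inputSet : Convex ℝ S.inputSet
  zero_mem_inputSet : 0 ∈ S.inputSet
  nonempty_uncertainty : S.uncertainty.Nonempty
  isCompact_uncertainty : IsCompact S.uncertainty
  convex_uncertainty : Convex ℝ S.uncertainty
  fullRank : ∃ d ∈ S.uncertainty, d.2.1.rank = m

/-- Compact convex robust control invariant (RCI) subsets of `𝕏`. -/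
structure IsRCI (S : UncertainSystem n m) (X : Set (Fin n → ℝ)) : Prop where
  isCompact : IsCompact X
  convex : Convex ℝ X
  subset : X ⊆ S.stateSet
  invariant : ∀ x ∈ X, ∃ u ∈ S.inputSet, ∀ d ∈ S.uncertainty, next d x u ∈ X

/-- Compact convex subsets `X` of `𝕏` that are robust `c`-contractive relative to `Xs`; the sum
is the Minkowski sum of the scaled sets. -/
structure IsRobustContractive (S : UncertainSystem n m) (c : ℝ) (X Xs : Set (Fin n → ℝ)) :
    Prop where
  isCompact : IsCompact X
  convex : Convex ℝ X
  subset : X ⊆ S.stateSet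
  contractive : ∀ x ∈ X, ∃ u ∈ S.inputSet, ∀ d ∈ S.uncertainty,
    next d x u ∈ c • X + (1 - c) • Xs

/-- A convex, non-negative stage cost `L` that is positive semi-definite with respect to `Xs`. -/
structure IsPosSemidefCost (S : UncertainSystem n m) (L : (Fin n → ℝ) → (Fin m → ℝ) → ℝ)
    (Xs : Set (Fin n → ℝ)) : Prop where
  convex : ConvexOn ℝ Set.univ (fun p : (Fin n → ℝ) × (Fin m → ℝ) => L p.1 p.2)
  nonneg : ∀ x u, 0 ≤ L x u
  zero_on : ∀ x ∈ Xs, ∃ u ∈ S.inputSet, L x u = 0 ∧ ∀ d ∈ S.uncertainty, next d x u ∈ Xs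

/-- The domain of an extended-real valued non-negative function: where it is finite. -/
def effDom (M : (Fin n → ℝ) → ℝ≥0∞) : Set (Fin n → ℝ) := {x | M x < ⊤}

/-- The epigraph `{(x, y) | M x ≤ y}`, a subset of `ℝⁿ × ℝ`. -/
def epigraph (M : (Fin n → ℝ) → ℝ≥0∞) : Set ((Fin n → ℝ) × ℝ) :=
  {p | (M p.1 : EReal) ≤ (p.2 : EReal)}

/-- Proper compact convex functions: the domain is non-empty and compact, the epigraph is closed
and convex. -/
structure IsProperCompactConvex (M : (Fin n → ℝ) → ℝ≥0∞) : Prop where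
  nonempty_dom : (effDom M).Nonempty
  isCompact_dom : IsCompact (effDom M)
  isClosed_epi : IsClosed (epigraph M)
  convex_epi : Convex ℝ (epigraph M)

open Classical in
/-- The indicator function `I_Y` of convex analysis: `0` on `Y` and `∞` off `Y`. -/
noncomputable def convIndicator (Y : Set (Fin n → ℝ)) (x : Fin n → ℝ) : ℝ≥0∞ :=
  if x ∈ Y then 0 else ⊤

/-- The worst-case one-step cost
`sup_{(A, B, w) ∈ 𝔻} L(x, u) + I_Y(x) + M(A x + B u + w)`, an element of `[0, ∞]`. -/
noncomputable def worstCost (S : UncertainSystem n m) (L : (Fin n → ℝ) → (Fin m → ℝ) → ℝ)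
    (Y : Set (Fin n → ℝ)) (M : (Fin n → ℝ) → ℝ≥0∞) (x : Fin n → ℝ) (u : Fin m → ℝ) : ℝ≥0∞ :=
  ⨆ d ∈ S.uncertainty, ENNReal.ofReal (L x u) + convIndicator Y x + M (next d x u)

/-- `v` is the minimum, attained over `u ∈ 𝕌`, of the worst-case one-step cost at `x`. -/
def IsMinMaxValue (S : UncertainSystem n m) (L : (Fin n → ℝ) → (Fin m → ℝ) → ℝ)
    (Y : Set (Fin n → ℝ)) (M : (Fin n → ℝ) → ℝ≥0∞) (x : Fin n → ℝ) (v : ℝ≥0∞) : Prop :=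
  IsLeast (worstCost S L Y M x '' S.inputSet) v

/-- Robust `L`-CLFs: non-negative, proper compact convex functions that vanish at some point of
`𝕏` and satisfy the robust control Lyapunov inequality at every `x ∈ ℝⁿ`. -/
structure IsRobustCLF (S : UncertainSystem n m) (L : (Fin n → ℝ) → (Fin m → ℝ) → ℝ)
    (M : (Fin n → ℝ) → ℝ≥0∞) : Prop where
  properCompactConvex : IsProperCompactConvex M
  exists_zero : ∃ x ∈ S.stateSet, M x = 0
  robustCLI : ∀ x, ∃ v, IsMinMaxValue S L S.stateSet M x v ∧ v ≤ M x

/-- The set of robust `L`-CLFs with domain `X`. -/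
def robustCLFs (S : UncertainSystem n m) (L : (Fin n → ℝ) → (Fin m → ℝ) → ℝ)
    (X : Set (Fin n → ℝ)) : Set ((Fin n → ℝ) → ℝ≥0∞) :=
  {M | IsRobustCLF S L M ∧ effDom M = X}

/-- `M` is a minimizer of `∫_X M dμ` over the robust `L`-CLFs with domain `X`. -/
def IsMinimizer (S : UncertainSystem n m) (L : (Fin n → ℝ) → (Fin m → ℝ) → ℝ)
    (X : Set (Fin n → ℝ)) (μ : Measure (Fin n → ℝ)) (M : (Fin n → ℝ) → ℝ≥0∞) : Prop :=
  M ∈ robustCLFs S L X ∧ ∀ M' ∈ robustCLFs S L X, ∫⁻ x in X, M x ∂μ ≤ ∫⁻ x in X, M' x ∂μ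

end UncertainSystem

/-! Value iteration started at the indicator of `X` increases to a limit `V`. This `V` is the
pointwise least robust CLF with domain `X`, so it minimizes the integral for every `μ`.

Compactness comes from full column rank: for one uncertainty, the state-control pairs that stay in
`X` form a compact set (`isCompact_setOf_next_mem`). Hence minima are attained, the Bellman operator
preserves closed convex functions, and nested compact sets of controls allow passing to the limit,
so `V` is a fixed point (`bellman_valueLimit`). Monotonicity puts `V` below every competitor
(`valueLimit_le`). Contractivity makes the worst-case costs a geometric series, so `V` is bounded on
`X` and vanishes on `Xs` (`exists_valueLimit_le`).

For uniqueness, another minimizer `M` satisfies `V ≤ M` with the same finite integral, so `M = V`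
almost everywhere, hence on a dense subset of the support `X`. Closed convex functions with domain
`X` are determined by such a subset (`eq_of_eqOn_dense`). -/

open Filter Topology

/-! ### Convex functions agreeing on a dense subset -/

/-- On a convex set with non-empty interior, a lower semicontinuous convex function is bounded by
every convex function with which it agrees on a dense subset. -/
theorem ConvexOn.le_of_eqOn_dense_of_interior_nonempty {W : Type*} [NormedAddCommGroup W]
    [NormedSpace ℝ W] [FiniteDimensional ℝ W] {K E : Set W} {f g : W → ℝ}
    (hint : (interior K).Nonempty) (hf : ConvexOn ℝ K f) (hg : ConvexOn ℝ K g)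
    (hlsc : LowerSemicontinuousOn f K) (hE : K ⊆ closure E) (hfg : Set.EqOn f g E)
    {x : W} (hx : x ∈ K) : f x ≤ g x := by
  -- Finite convex functions are continuous on the interior, so agreement there follows by density.
  have key : ∀ y ∈ interior K, f y = g y := by
    intro y hy
    have hne : (𝓝[E] y).NeBot := mem_closure_iff_nhdsWithin_neBot.1 (hE (interior_subset hy))
    have h1 : Tendsto f (𝓝[E] y) (𝓝 (f y)) :=
      (hf.continuousOn_interior.continuousAt (isOpen_interior.mem_nhds hy)).tendsto.mono_left
        nhdsWithin_le_nhds
    have h2 : Tendsto g (𝓝[E] y) (𝓝 (g y)) :=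
      (hg.continuousOn_interior.continuousAt (isOpen_interior.mem_nhds hy)).tendsto.mono_left
        nhdsWithin_le_nhds
    exact tendsto_nhds_unique (h1.congr' (eventually_nhdsWithin_of_forall hfg)) h2
  obtain ⟨y, hy⟩ := hint
  refine le_of_forall_lt fun a ha => ?_
  obtain ⟨b, hab, hb⟩ := exists_between ha
  refine lt_of_lt_of_le hab ?_
  -- Approach `x` along the segment from an interior point: lower semicontinuity controls `f` from
  -- below, and convexity bounds `g` above by the chord, which tends to `g x`.
  have hpc : Continuous fun t : ℝ => (1 - t) • x + t • y := by fun_prop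
  have hp0 : Tendsto (fun t : ℝ => (1 - t) • x + t • y) (𝓝[>] 0) (𝓝 x) := by
    have := (hpc.tendsto 0).mono_left (nhdsWithin_le_nhds (s := Set.Ioi 0))
    simpa using this
  have hmem : ∀ᶠ t : ℝ in 𝓝[>] 0, 0 < t ∧ t < 1 := Ioo_mem_nhdsGT one_pos
  have hpi : ∀ t : ℝ, 0 < t ∧ t < 1 → (1 - t) • x + t • y ∈ interior K := fun t ht =>
    hf.1.combo_self_interior_mem_interior hx hy (by linarith [ht.2]) ht.1 (by ring)
  have hpK : Tendsto (fun t : ℝ => (1 - t) • x + t • y) (𝓝[>] 0) (𝓝[K] x) :=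
    tendsto_nhdsWithin_iff.2 ⟨hp0, hmem.mono fun t ht => interior_subset (hpi t ht)⟩
  have hgl : Tendsto (fun t : ℝ => (1 - t) * g x + t * g y) (𝓝[>] 0) (𝓝 (g x)) := by
    have hc : Continuous fun t : ℝ => (1 - t) * g x + t * g y := by fun_prop
    have := (hc.tendsto 0).mono_left (nhdsWithin_le_nhds (s := Set.Ioi 0))
    simpa using this
  refine ge_of_tendsto hgl ?_
  filter_upwards [hmem, hpK.eventually (hlsc x hx b hb)] with t ht hbt
  refine hbt.le.trans ?_
  rw [key _ (hpi t ht)]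
  simpa using hg.2 hx (interior_subset hy) (by linarith [ht.2] : (0 : ℝ) ≤ 1 - t) ht.1.le (by ring)

/-- A lower semicontinuous convex function on a convex set in a finite-dimensional space is bounded
by every convex function with which it agrees on a dense subset. -/
theorem ConvexOn.le_of_eqOn_dense {V : Type*} [NormedAddCommGroup V] [NormedSpace ℝ V]
    [FiniteDimensional ℝ V] {K E : Set V} {f g : V → ℝ} (hf : ConvexOn ℝ K f)
    (hg : ConvexOn ℝ K g) (hlsc : LowerSemicontinuousOn f K) (hEK : E ⊆ K) (hE : K ⊆ closure E)
    (hfg : Set.EqOn f g E) {x : V} (hx : x ∈ K) : f x ≤ g x := by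
  -- The affine hull of `K` is parametrized with `x` as origin; inside it `K` has non-empty
  -- interior.
  let W : Submodule ℝ V := vectorSpan ℝ K
  let ψ : W →ᵃ[ℝ] V := W.subtype.toAffineMap + AffineMap.const ℝ W x
  have hψ : ∀ w : W, ψ w = (w : V) + x := fun w => rfl
  have hψc : Continuous ψ := by
    change Continuous fun w : W => (w : V) + x
    fun_prop
  have hψi : IsInducing ψ :=
    (Homeomorph.addRight x).isInducing.comp (IsInducing.subtypeVal (t := (W : Set V)))
  have hψl : ψ.linear = W.subtype := by
    ext w
    simp [ψ]
  have hrange : K ⊆ Set.range ψ := fun y hy =>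
    ⟨⟨y - x, vsub_mem_vectorSpan ℝ hy hx⟩, by simp [hψ]⟩
  have himg : ψ '' (ψ ⁻¹' K) = K := Set.image_preimage_eq_of_subset hrange
  have hconv : Convex ℝ (ψ ⁻¹' K) := hf.1.affine_preimage ψ
  have hne : (ψ ⁻¹' K).Nonempty := ⟨0, by simpa [hψ] using hx⟩
  have hint : (interior (ψ ⁻¹' K)).Nonempty := by
    rw [hconv.interior_nonempty_iff_affineSpan_eq_top,
      AffineSubspace.affineSpan_eq_top_iff_vectorSpan_eq_top_of_nonempty _ _ _ hne]
    have h := AffineMap.map_vectorSpan (f := ψ) (s := ψ ⁻¹' K)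
    rw [himg, hψl] at h
    apply Submodule.map_injective_of_injective W.injective_subtype
    rw [h, Submodule.map_top, Submodule.range_subtype]
  have hdense : ψ ⁻¹' K ⊆ closure (ψ ⁻¹' E) := by
    rw [hψi.closure_eq_preimage_closure_image,
      Set.image_preimage_eq_of_subset (hEK.trans hrange)]
    exact Set.preimage_mono hE
  have h0 := ConvexOn.le_of_eqOn_dense_of_interior_nonempty hint (hf.comp_affineMap ψ)
    (hg.comp_affineMap ψ) (hlsc.comp hψc.continuousOn (Set.mapsTo_preimage ψ K)) hdense
    (fun w hw => hfg hw) (x := 0) (by simpa [hψ] using hx)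
  simpa [hψ] using h0

/-! ### Epigraphs and lower semicontinuity of `[0, ∞]`-valued functions -/

namespace UncertainSystem

variable {n m : ℕ}

/-- `ENNReal.ofReal` truncates negative heights to `0`, so their exclusion needs a separate sign
condition. -/
theorem mem_epigraph {M : (Fin n → ℝ) → ℝ≥0∞} {p : (Fin n → ℝ) × ℝ} :
    p ∈ epigraph M ↔ 0 ≤ p.2 ∧ M p.1 ≤ ENNReal.ofReal p.2 := by
  constructor
  · intro h
    have h0 : 0 ≤ p.2 := by
      have : (0 : EReal) ≤ (p.2 : EReal) := (EReal.coe_ennreal_nonneg _).trans h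
      exact_mod_cast this
    refine ⟨h0, ?_⟩
    rw [← EReal.coe_ennreal_le_coe_ennreal_iff, EReal.coe_ennreal_ofReal, max_eq_left h0]
    exact h
  · rintro ⟨h0, h⟩
    rw [← EReal.coe_ennreal_le_coe_ennreal_iff, EReal.coe_ennreal_ofReal, max_eq_left h0] at h
    exact h

theorem _root_.ENNReal.lowerSemicontinuous_iff_isClosed_le_ofReal {α : Type*} [TopologicalSpace α]
    {f : α → ℝ≥0∞} :
    LowerSemicontinuous f ↔ ∀ r : ℝ, 0 ≤ r → IsClosed {x | f x ≤ ENNReal.ofReal r} := by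
  rw [lowerSemicontinuous_iff_isClosed_preimage]
  refine ⟨fun h r _ => h _, fun h y => ?_⟩
  by_cases hy : y = ⊤
  · simp [hy]
  · have := h y.toReal ENNReal.toReal_nonneg
    rwa [ENNReal.ofReal_toReal hy] at this

theorem isClosed_epigraph_iff {M : (Fin n → ℝ) → ℝ≥0∞} :
    IsClosed (epigraph M) ↔ LowerSemicontinuous M := by
  constructor
  · intro h
    refine ENNReal.lowerSemicontinuous_iff_isClosed_le_ofReal.2 fun r hr => ?_
    have hc : Continuous fun x : Fin n → ℝ => (x, r) := by fun_prop
    convert h.preimage hc using 1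
    ext x
    simp [mem_epigraph, hr]
  · intro h
    have hc : Continuous fun p : (Fin n → ℝ) × ℝ => (p.1, ENNReal.ofReal p.2) :=
      continuous_fst.prodMk (ENNReal.continuous_ofReal.comp continuous_snd)
    convert (isClosed_le (continuous_const (y := (0 : ℝ))) continuous_snd).inter
      ((lowerSemicontinuous_iff_isClosed_epigraph.1 h).preimage hc) using 1
    ext p
    simp [mem_epigraph]

theorem convexOn_toReal {M : (Fin n → ℝ) → ℝ≥0∞} {X : Set (Fin n → ℝ)} (hX : Convex ℝ X)
    (hdom : effDom M = X) (hM : Convex ℝ (epigraph M)) : ConvexOn ℝ X fun x => (M x).toReal := by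
  have hmem : ∀ x ∈ X, (x, (M x).toReal) ∈ epigraph M := fun x hx => by
    rw [← hdom] at hx
    exact mem_epigraph.2 ⟨ENNReal.toReal_nonneg, (ENNReal.ofReal_toReal (ne_of_lt hx)).ge⟩
  refine ⟨hX, fun x hx y hy a b ha hb hab => ?_⟩
  have h := mem_epigraph.1 (hM (hmem x hx) (hmem y hy) ha hb hab)
  exact ENNReal.toReal_le_of_le_ofReal h.1 h.2

theorem lowerSemicontinuousOn_toReal {M : (Fin n → ℝ) → ℝ≥0∞} (hM : LowerSemicontinuous M) :
    LowerSemicontinuousOn (fun x => (M x).toReal) (effDom M) := by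
  intro x hx a ha
  rcases lt_or_ge a 0 with h0 | h0
  · exact Eventually.of_forall fun y => h0.trans_le ENNReal.toReal_nonneg
  · have h1 : ENNReal.ofReal a < M x := (ENNReal.ofReal_lt_iff_lt_toReal h0 (ne_of_lt hx)).2 ha
    filter_upwards [mem_nhdsWithin_of_mem_nhds (hM x _ h1), self_mem_nhdsWithin] with y hy hyX
    exact (ENNReal.ofReal_lt_iff_lt_toReal h0 (ne_of_lt hyX)).1 hy

/-- Two closed convex functions with the same domain that agree on a dense subset of it agree. -/
theorem eq_of_eqOn_dense {M N : (Fin n → ℝ) → ℝ≥0∞} {X E : Set (Fin n → ℝ)} (hX : Convex ℝ X)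
    (hMd : effDom M = X) (hNd : effDom N = X) (hMc : Convex ℝ (epigraph M))
    (hNc : Convex ℝ (epigraph N)) (hMl : LowerSemicontinuous M) (hNl : LowerSemicontinuous N)
    (hEX : E ⊆ X) (hE : X ⊆ closure E) (h : Set.EqOn M N E) : M = N := by
  funext x
  by_cases hx : x ∈ X
  · have hM := convexOn_toReal hX hMd hMc
    have hN := convexOn_toReal hX hNd hNc
    have hMlX := lowerSemicontinuousOn_toReal hMl
    have hNlX := lowerSemicontinuousOn_toReal hNl
    rw [hMd] at hMlX
    rw [hNd] at hNlX
    have hMx : M x ≠ ⊤ := ne_of_lt (show x ∈ effDom M from hMd ▸ hx)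
    have hNx : N x ≠ ⊤ := ne_of_lt (show x ∈ effDom N from hNd ▸ hx)
    refine (ENNReal.toReal_eq_toReal_iff' hMx hNx).1 (le_antisymm ?_ ?_)
    · exact hM.le_of_eqOn_dense hN hMlX hEX hE (fun y hy => congrArg ENNReal.toReal (h hy)) hx
    · exact hN.le_of_eqOn_dense hM hNlX hEX hE
        (fun y hy => congrArg ENNReal.toReal (h hy).symm) hx
  · have hMx : x ∉ effDom M := hMd ▸ hx
    have hNx : x ∉ effDom N := hNd ▸ hx
    exact (not_lt_top_iff.1 hMx).trans (not_lt_top_iff.1 hNx).symm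

/-! ### Dynamics and worst-case cost -/

variable {S : UncertainSystem n m} {L : (Fin n → ℝ) → (Fin m → ℝ) → ℝ}
  {X Y : Set (Fin n → ℝ)} {M N : (Fin n → ℝ) → ℝ≥0∞}

@[fun_prop]
theorem continuous_next (d : Matrix (Fin n) (Fin n) ℝ × Matrix (Fin n) (Fin m) ℝ × (Fin n → ℝ)) :
    Continuous fun p : (Fin n → ℝ) × (Fin m → ℝ) => next d p.1 p.2 := by
  unfold next
  fun_prop

theorem next_combo (d : Matrix (Fin n) (Fin n) ℝ × Matrix (Fin n) (Fin m) ℝ × (Fin n → ℝ))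
    (x x' : Fin n → ℝ) (u u' : Fin m → ℝ) {a b : ℝ} (hab : a + b = 1) :
    next d (a • x + b • x') (a • u + b • u') = a • next d x u + b • next d x' u' := by
  simp only [next, Matrix.mulVec_add, Matrix.mulVec_smul, smul_add]
  nth_rewrite 1 [← one_smul ℝ d.2.2]
  rw [← hab, add_smul]
  abel

/-- If the input matrix has full column rank, then the pairs of a state in a compact set and a
control that steers it into a compact set form a compact set. -/
theorem isCompact_setOf_next_mem
    {d : Matrix (Fin n) (Fin n) ℝ × Matrix (Fin n) (Fin m) ℝ × (Fin n → ℝ)}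
    (hd : d.2.1.rank = m) {K K' : Set (Fin n → ℝ)} (hK : IsCompact K) (hK' : IsCompact K') :
    IsCompact {p : (Fin n → ℝ) × (Fin m → ℝ) | p.1 ∈ K ∧ next d p.1 p.2 ∈ K'} := by
  have hker : LinearMap.ker d.2.1.mulVecLin = ⊥ := by
    have h := d.2.1.mulVecLin.finrank_range_add_finrank_ker
    rw [show Module.finrank ℝ (LinearMap.range d.2.1.mulVecLin) = m from hd,
      Module.finrank_fin_fun] at h
    exact Submodule.finrank_eq_zero.1 (by omega)
  obtain ⟨G, hG⟩ := d.2.1.mulVecLin.exists_leftInverse_of_injective hker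
  have hGc : Continuous G := G.continuous_of_finiteDimensional
  have hG' : ∀ u, G (d.2.1.mulVec u) = u := fun u => LinearMap.congr_fun hG u
  -- The left inverse `G` recovers the control continuously from a state and its successor, so the
  -- set is a closed part of the compact image of `K ×ˢ K'`.
  let φ : (Fin n → ℝ) × (Fin n → ℝ) → (Fin n → ℝ) × (Fin m → ℝ) :=
    fun q => (q.1, G (q.2 - d.1.mulVec q.1 - d.2.2))
  have hφ : Continuous φ := by
    refine continuous_fst.prodMk (hGc.comp ?_)
    fun_prop
  refine ((hK.prod hK').image hφ).of_isClosed_subset ?_ ?_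
  · exact (hK.isClosed.preimage continuous_fst).inter (hK'.isClosed.preimage (continuous_next d))
  · rintro ⟨x, u⟩ ⟨hx, hu⟩
    refine ⟨(x, next d x u), ⟨hx, hu⟩, Prod.ext rfl ?_⟩
    simp only [φ, next]
    rw [show d.1.mulVec x + d.2.1.mulVec u + d.2.2 - d.1.mulVec x - d.2.2 = d.2.1.mulVec u by abel,
      hG']

theorem worstCost_mono (h : M ≤ N) (x : Fin n → ℝ) (u : Fin m → ℝ) :
    worstCost S L Y M x u ≤ worstCost S L Y N x u := by
  unfold worstCost
  gcongr with d hd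
  exact h _

theorem worstCost_eq_top_of_notMem (hD : S.uncertainty.Nonempty) {x : Fin n → ℝ} (hx : x ∉ Y)
    (u : Fin m → ℝ) : worstCost S L Y M x u = ⊤ := by
  obtain ⟨d, hd⟩ := hD
  refine top_le_iff.1 (le_iSup₂_of_le d hd ?_)
  simp [convIndicator, hx]

theorem worstCost_congr {x : Fin n → ℝ} (hX : x ∈ X) (hY : x ∈ Y) :
    worstCost S L X M x = worstCost S L Y M x := by
  funext u
  simp [worstCost, convIndicator, hX, hY]

theorem next_mem_of_worstCost_ne_top {x : Fin n → ℝ} {u : Fin m → ℝ}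
    (h : worstCost S L Y M x u ≠ ⊤)
    {d : Matrix (Fin n) (Fin n) ℝ × Matrix (Fin n) (Fin m) ℝ × (Fin n → ℝ)}
    (hd : d ∈ S.uncertainty) : next d x u ∈ effDom M := by
  refine lt_of_le_of_lt ?_ (lt_top_iff_ne_top.2 h)
  exact le_iSup₂_of_le d hd le_add_self

/-- The inequality `worstCost ≤ r` in terms of the epigraph of `M`. -/
theorem worstCost_le_ofReal_iff (hD : S.uncertainty.Nonempty) (hL : ∀ x u, 0 ≤ L x u)
    {x : Fin n → ℝ} {u : Fin m → ℝ} {r : ℝ} :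
    (0 ≤ r ∧ worstCost S L Y M x u ≤ ENNReal.ofReal r) ↔
      x ∈ Y ∧ ∀ d ∈ S.uncertainty, (next d x u, r - L x u) ∈ epigraph M := by
  by_cases hx : x ∈ Y
  · simp only [worstCost, convIndicator, hx, if_true, add_zero, iSup_le_iff, true_and,
      mem_epigraph]
    constructor
    · rintro ⟨hr, h⟩ d hd
      have h1 := h d hd
      have h2 : L x u ≤ r := (ENNReal.ofReal_le_ofReal_iff hr).1 (le_self_add.trans h1)
      refine ⟨sub_nonneg.2 h2, ?_⟩
      rw [ENNReal.ofReal_sub _ (hL x u)]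
      exact ENNReal.le_sub_of_add_le_left ENNReal.ofReal_ne_top h1
    · intro h
      -- A single uncertainty already forces `0 ≤ L x u ≤ r`.
      obtain ⟨d₀, hd₀⟩ := hD
      have h2 : L x u ≤ r := sub_nonneg.1 (h d₀ hd₀).1
      refine ⟨(hL x u).trans h2, fun d hd => ?_⟩
      calc ENNReal.ofReal (L x u) + M (next d x u)
          ≤ ENNReal.ofReal (L x u) + ENNReal.ofReal (r - L x u) := by gcongr; exact (h d hd).2
        _ = ENNReal.ofReal r := by
          rw [← ENNReal.ofReal_add (hL x u) (sub_nonneg.2 h2), add_sub_cancel]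
  · simp [worstCost_eq_top_of_notMem hD hx, hx]

/-- Each sublevel set is an intersection of preimages of closed sets: `Y`, and the epigraph of `M`
once per uncertainty. -/
theorem lowerSemicontinuous_worstCost (hD : S.uncertainty.Nonempty) (hL : ∀ x u, 0 ≤ L x u)
    (hLc : Continuous fun p : (Fin n → ℝ) × (Fin m → ℝ) => L p.1 p.2) (hY : IsClosed Y)
    (hM : LowerSemicontinuous M) :
    LowerSemicontinuous fun p : (Fin n → ℝ) × (Fin m → ℝ) => worstCost S L Y M p.1 p.2 := by
  refine ENNReal.lowerSemicontinuous_iff_isClosed_le_ofReal.2 fun r hr => ?_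
  have h1 : {p : (Fin n → ℝ) × (Fin m → ℝ) | worstCost S L Y M p.1 p.2 ≤ ENNReal.ofReal r} =
      Prod.fst ⁻¹' Y ∩ ⋂ d ∈ S.uncertainty,
        (fun p => (next d p.1 p.2, r - L p.1 p.2)) ⁻¹' epigraph M := by
    ext p
    have := worstCost_le_ofReal_iff (Y := Y) (M := M) (x := p.1) (u := p.2) (r := r) hD hL
    simp only [hr, true_and] at this
    simpa using this
  rw [h1]
  refine (hY.preimage continuous_fst).inter (isClosed_biInter fun d _ => ?_)
  exact (isClosed_epigraph_iff.2 hM).preimage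
    ((continuous_next d).prodMk (continuous_const.sub hLc))

/-! ### The Bellman operator -/

/-- The Bellman operator: the infimum over the admissible controls of the worst-case cost. -/
noncomputable def bellman (S : UncertainSystem n m) (L : (Fin n → ℝ) → (Fin m → ℝ) → ℝ)
    (Y : Set (Fin n → ℝ)) (M : (Fin n → ℝ) → ℝ≥0∞) (x : Fin n → ℝ) : ℝ≥0∞ :=
  ⨅ u ∈ S.inputSet, worstCost S L Y M x u

theorem bellman_le {x : Fin n → ℝ} {u : Fin m → ℝ} (hu : u ∈ S.inputSet) :
    bellman S L Y M x ≤ worstCost S L Y M x u :=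
  iInf₂_le u hu

theorem bellman_mono (h : M ≤ N) : bellman S L Y M ≤ bellman S L Y N :=
  fun x => iInf₂_mono fun u _ => worstCost_mono h x u

theorem bellman_eq_top_of_notMem (hD : S.uncertainty.Nonempty) {x : Fin n → ℝ} (hx : x ∉ Y) :
    bellman S L Y M x = ⊤ := by
  simp [bellman, worstCost_eq_top_of_notMem hD hx]

theorem IsMinMaxValue.eq_bellman {x : Fin n → ℝ} {v : ℝ≥0∞} (h : S.IsMinMaxValue L Y M x v) :
    v = bellman S L Y M x := by
  refine le_antisymm (le_iInf₂ fun u hu => h.2 ⟨u, hu, rfl⟩) ?_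
  obtain ⟨u, hu, rfl⟩ := h.1
  exact bellman_le hu

/-- The minimum over the controls is attained. -/
theorem isMinMaxValue_bellman (hS : S.StandingAssumptions) (hL : ∀ x u, 0 ≤ L x u)
    (hLc : Continuous fun p : (Fin n → ℝ) × (Fin m → ℝ) => L p.1 p.2) (hY : IsClosed Y)
    (hM : LowerSemicontinuous M) (hX : IsCompact X) (hMX : effDom M ⊆ X) (x : Fin n → ℝ) :
    S.IsMinMaxValue L Y M x (bellman S L Y M x) := by
  suffices h : ∃ u ∈ S.inputSet, ∀ v ∈ S.inputSet, worstCost S L Y M x u ≤ worstCost S L Y M x v by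
    obtain ⟨u, hu, huv⟩ := h
    have hleast : S.IsMinMaxValue L Y M x (worstCost S L Y M x u) := by
      refine ⟨⟨u, hu, rfl⟩, ?_⟩
      rintro _ ⟨v, hv, rfl⟩
      exact huv v hv
    rwa [hleast.eq_bellman] at hleast
  obtain ⟨d, hd, hrank⟩ := hS.fullRank
  -- Controls outside `K` cost `⊤`, so only the compact set `K` matters; if it is empty, every
  -- control is optimal.
  let K : Set (Fin m → ℝ) := {u | u ∈ S.inputSet ∧ next d x u ∈ X}
  have htop : ∀ v ∈ S.inputSet, v ∉ K → worstCost S L Y M x v = ⊤ := fun v hv hvK => by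
    by_contra h
    exact hvK ⟨hv, hMX (next_mem_of_worstCost_ne_top h hd)⟩
  have hc : Continuous fun u : Fin m → ℝ => (x, u) := by fun_prop
  have hKc : IsCompact K := by
    refine ((isCompact_setOf_next_mem hrank (isCompact_singleton (x := x)) hX).image
      continuous_snd).of_isClosed_subset ?_ ?_
    · exact hS.isClosed_inputSet.inter (hX.isClosed.preimage ((continuous_next d).comp hc))
    · rintro u ⟨-, hu⟩
      exact ⟨(x, u), ⟨rfl, hu⟩, rfl⟩
  rcases K.eq_empty_or_nonempty with hK | hK
  · refine ⟨0, hS.zero_mem_inputSet, fun v hv => ?_⟩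
    rw [htop v hv (by simp [hK])]
    exact le_top
  · have hlsc : LowerSemicontinuous fun u => worstCost S L Y M x u := fun u a ha =>
      hc.continuousAt.eventually
        (lowerSemicontinuous_worstCost hS.nonempty_uncertainty hL hLc hY hM (x, u) a ha)
    obtain ⟨u, hu, hmin⟩ := (hlsc.lowerSemicontinuousOn K).exists_isMinOn hK hKc
    refine ⟨u, hu.1, fun v hv => ?_⟩
    by_cases hvK : v ∈ K
    · exact hmin hvK
    · rw [htop v hv hvK]
      exact le_top

/-- The Bellman operator preserves lower semicontinuity. -/
theorem lowerSemicontinuous_bellman (hS : S.StandingAssumptions) (hL : ∀ x u, 0 ≤ L x u)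
    (hLc : Continuous fun p : (Fin n → ℝ) × (Fin m → ℝ) => L p.1 p.2) (hX : IsCompact X)
    (hM : LowerSemicontinuous M) (hMX : effDom M ⊆ X) :
    LowerSemicontinuous (bellman S L X M) := by
  refine ENNReal.lowerSemicontinuous_iff_isClosed_le_ofReal.2 fun r hr => ?_
  obtain ⟨d, hd, hrank⟩ := hS.fullRank
  have hlsc := lowerSemicontinuous_worstCost (S := S) hS.nonempty_uncertainty hL hLc hX.isClosed hM
  have hcl : IsClosed {p : (Fin n → ℝ) × (Fin m → ℝ) |
      worstCost S L X M p.1 p.2 ≤ ENNReal.ofReal r} :=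
    ENNReal.lowerSemicontinuous_iff_isClosed_le_ofReal.1 hlsc r hr
  -- Since minima are attained, the sublevel set is exactly the projection of this compact set.
  have hcomp := (isCompact_setOf_next_mem hrank hX hX).inter_right
    (hcl.inter (hS.isClosed_inputSet.preimage continuous_snd))
  convert (hcomp.image continuous_fst).isClosed using 1
  ext x
  constructor
  · intro hx
    obtain ⟨u, hu, hxu⟩ :=
      (isMinMaxValue_bellman (L := L) hS hL hLc hX.isClosed hM hX hMX x).1
    have hle : worstCost S L X M x u ≤ ENNReal.ofReal r := hxu.le.trans hx
    have hne := ne_top_of_le_ne_top ENNReal.ofReal_ne_top hle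
    refine ⟨(x, u), ⟨⟨?_, hMX (next_mem_of_worstCost_ne_top hne hd)⟩, hle, hu⟩, rfl⟩
    by_contra hxX
    exact hne (worstCost_eq_top_of_notMem hS.nonempty_uncertainty hxX u)
  · rintro ⟨⟨x, u⟩, ⟨-, hle, hu⟩, rfl⟩
    exact (bellman_le hu).trans hle

/-- The Bellman operator preserves convexity. -/
theorem convex_epigraph_bellman (hS : S.StandingAssumptions) (hL : ∀ x u, 0 ≤ L x u)
    (hLconv : ConvexOn ℝ Set.univ fun p : (Fin n → ℝ) × (Fin m → ℝ) => L p.1 p.2)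
    (hLc : Continuous fun p : (Fin n → ℝ) × (Fin m → ℝ) => L p.1 p.2) (hX : IsCompact X)
    (hXc : Convex ℝ X) (hM : LowerSemicontinuous M) (hMc : Convex ℝ (epigraph M))
    (hMX : effDom M ⊆ X) : Convex ℝ (epigraph (bellman S L X M)) := by
  have key : ∀ p ∈ epigraph (bellman S L X M), ∃ u ∈ S.inputSet,
      p.1 ∈ X ∧ ∀ d ∈ S.uncertainty, (next d p.1 u, p.2 - L p.1 u) ∈ epigraph M := by
    intro p hp
    obtain ⟨h0, h1⟩ := mem_epigraph.1 hp
    obtain ⟨u, hu, hxu⟩ :=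
      (isMinMaxValue_bellman (L := L) hS hL hLc hX.isClosed hM hX hMX p.1).1
    exact ⟨u, hu, (worstCost_le_ofReal_iff hS.nonempty_uncertainty hL).1 ⟨h0, hxu.le.trans h1⟩⟩
  rintro ⟨x, r⟩ hx ⟨y, s⟩ hy a b ha hb hab
  -- Optimal controls at the two endpoints are mixed with the same weights as the states.
  obtain ⟨u, hu, hxX, hxd⟩ := key _ hx
  obtain ⟨v, hv, hyX, hyd⟩ := key _ hy
  obtain ⟨h0, h1⟩ := (worstCost_le_ofReal_iff (S := S) (L := L) (Y := X) (M := M)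
      (x := a • x + b • y) (u := a • u + b • v) (r := a * r + b * s)
      hS.nonempty_uncertainty hL).2 ⟨hXc hxX hyX ha hb hab, fun d hd => by
    have h := mem_epigraph.1 (hMc (hxd d hd) (hyd d hd) ha hb hab)
    have hLle := hLconv.2 (Set.mem_univ (x, u)) (Set.mem_univ (y, v)) ha hb hab
    simp only [Prod.smul_mk, Prod.mk_add_mk, smul_eq_mul] at h hLle
    rw [next_combo d x y u v hab]
    have hle : a * (r - L x u) + b * (s - L y v) ≤
        a * r + b * s - L (a • x + b • y) (a • u + b • v) := by linarith
    exact mem_epigraph.2 ⟨h.1.trans hle, h.2.trans (ENNReal.ofReal_le_ofReal hle)⟩⟩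
  exact mem_epigraph.2 ⟨h0, (bellman_le (hS.convex_inputSet hu hv ha hb hab)).trans h1⟩

/-! ### Value iteration and its limit -/

/-- Value iteration, started at the indicator function of `X`. -/
noncomputable def valueIter (S : UncertainSystem n m) (L : (Fin n → ℝ) → (Fin m → ℝ) → ℝ)
    (X : Set (Fin n → ℝ)) : ℕ → (Fin n → ℝ) → ℝ≥0∞
  | 0 => convIndicator X
  | k + 1 => bellman S L X (valueIter S L X k)

/-- The limit of value iteration. -/
noncomputable def valueLimit (S : UncertainSystem n m) (L : (Fin n → ℝ) → (Fin m → ℝ) → ℝ)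
    (X : Set (Fin n → ℝ)) (x : Fin n → ℝ) : ℝ≥0∞ :=
  ⨆ k, valueIter S L X k x

/-- Supplies the base case of the comparison inductions on value iteration. -/
theorem convIndicator_le_iff : convIndicator X ≤ M ↔ effDom M ⊆ X := by
  constructor
  · intro h x hx
    by_contra hxX
    have := (h x).trans_lt hx
    simp [convIndicator, hxX] at this
  · intro h x
    by_cases hx : x ∈ X
    · simp [convIndicator, hx]
    · have : ¬ M x < ⊤ := fun h' => hx (h h')
      rw [not_lt_top_iff.1 this]
      exact le_top

theorem valueIter_monotone (hD : S.uncertainty.Nonempty) : Monotone (valueIter S L X) := by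
  refine monotone_nat_of_le_succ fun k => ?_
  induction k with
  | zero =>
    refine convIndicator_le_iff.2 fun x hx => ?_
    by_contra hxX
    exact (ne_of_lt hx) (bellman_eq_top_of_notMem hD hxX)
  | succ k ih => exact bellman_mono ih

theorem valueIter_le_valueLimit (k : ℕ) : valueIter S L X k ≤ valueLimit S L X :=
  fun x => le_iSup (fun k => valueIter S L X k x) k

theorem effDom_valueIter_subset (hD : S.uncertainty.Nonempty) (k : ℕ) :
    effDom (valueIter S L X k) ⊆ X :=
  convIndicator_le_iff.1 (valueIter_monotone hD (Nat.zero_le k))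

theorem effDom_valueLimit_subset : effDom (valueLimit S L X) ⊆ X :=
  convIndicator_le_iff.1 (valueIter_le_valueLimit 0)

/-- Both properties go through one induction, because preserving convexity uses attained minima,
which rest on lower semicontinuity. -/
theorem valueIter_regular (hS : S.StandingAssumptions) (hL : ∀ x u, 0 ≤ L x u)
    (hLconv : ConvexOn ℝ Set.univ fun p : (Fin n → ℝ) × (Fin m → ℝ) => L p.1 p.2)
    (hX : IsCompact X) (hXc : Convex ℝ X) (k : ℕ) :
    LowerSemicontinuous (valueIter S L X k) ∧ Convex ℝ (epigraph (valueIter S L X k)) := by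
  have hLc : Continuous fun p : (Fin n → ℝ) × (Fin m → ℝ) => L p.1 p.2 :=
    hLconv.locallyLipschitz.continuous
  induction k with
  | zero =>
    have hmem : ∀ r x, convIndicator X x ≤ ENNReal.ofReal r ↔ x ∈ X := fun r x => by
      by_cases hx : x ∈ X <;> simp [convIndicator, hx]
    refine ⟨ENNReal.lowerSemicontinuous_iff_isClosed_le_ofReal.2 fun r _ => ?_, ?_⟩
    · simpa only [valueIter, hmem, Set.ofPred_mem_eq] using hX.isClosed
    · have : epigraph (valueIter S L X 0) = X ×ˢ Set.Ici 0 := by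
        ext p
        rw [mem_epigraph, valueIter, hmem, Set.mem_prod, Set.mem_Ici, and_comm]
      rw [this]
      exact hXc.prod (convex_Ici 0)
  | succ k ih =>
    have hsub := effDom_valueIter_subset (L := L) (X := X) hS.nonempty_uncertainty k
    exact ⟨lowerSemicontinuous_bellman hS hL hLc hX ih.1 hsub,
      convex_epigraph_bellman hS hL hLconv hLc hX hXc ih.1 ih.2 hsub⟩

theorem lowerSemicontinuous_valueLimit (hS : S.StandingAssumptions) (hL : ∀ x u, 0 ≤ L x u)
    (hLconv : ConvexOn ℝ Set.univ fun p : (Fin n → ℝ) × (Fin m → ℝ) => L p.1 p.2)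
    (hX : IsCompact X) (hXc : Convex ℝ X) : LowerSemicontinuous (valueLimit S L X) :=
  lowerSemicontinuous_iSup fun k => (valueIter_regular hS hL hLconv hX hXc k).1

theorem convex_epigraph_valueLimit (hS : S.StandingAssumptions) (hL : ∀ x u, 0 ≤ L x u)
    (hLconv : ConvexOn ℝ Set.univ fun p : (Fin n → ℝ) × (Fin m → ℝ) => L p.1 p.2)
    (hX : IsCompact X) (hXc : Convex ℝ X) : Convex ℝ (epigraph (valueLimit S L X)) := by
  have : epigraph (valueLimit S L X) = ⋂ k, epigraph (valueIter S L X k) := by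
    ext p
    simp only [Set.mem_iInter, mem_epigraph, valueLimit, iSup_le_iff]
    exact ⟨fun h k => ⟨h.1, h.2 k⟩, fun h => ⟨(h 0).1, fun k => (h k).2⟩⟩
  rw [this]
  exact convex_iInter fun k => (valueIter_regular hS hL hLconv hX hXc k).2

theorem worstCost_valueLimit (x : Fin n → ℝ) (u : Fin m → ℝ) :
    worstCost S L Y (valueLimit S L X) x u = ⨆ k, worstCost S L Y (valueIter S L X k) x u := by
  simp only [worstCost, valueLimit, ENNReal.add_iSup]
  rw [iSup_comm]
  exact iSup_congr fun d => iSup_comm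

/-- The limit of value iteration solves the min-max Bellman equation. -/
theorem bellman_valueLimit (hS : S.StandingAssumptions) (hL : ∀ x u, 0 ≤ L x u)
    (hLconv : ConvexOn ℝ Set.univ fun p : (Fin n → ℝ) × (Fin m → ℝ) => L p.1 p.2)
    (hX : IsCompact X) (hXc : Convex ℝ X) :
    bellman S L X (valueLimit S L X) = valueLimit S L X := by
  have hLc : Continuous fun p : (Fin n → ℝ) × (Fin m → ℝ) => L p.1 p.2 :=
    hLconv.locallyLipschitz.continuous
  have hD := hS.nonempty_uncertainty
  refine le_antisymm (fun x => ?_) fun x => iSup_le fun k => ?_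
  · by_cases htop : valueLimit S L X x = ⊤
    · rw [htop]
      exact le_top
    have hxX : x ∈ X := effDom_valueLimit_subset (lt_top_iff_ne_top.2 htop)
    obtain ⟨d, hd, hrank⟩ := hS.fullRank
    -- These sets are nested, compact and non-empty (the minimum at stage `k` is the iterate `k +
    -- 1`, which is at most the limit). A common control is good for all `k` at once.
    let C : ℕ → Set (Fin m → ℝ) := fun k =>
      {u | u ∈ S.inputSet ∧ worstCost S L X (valueIter S L X k) x u ≤ valueLimit S L X x}
    have hc : Continuous fun u : Fin m → ℝ => (x, u) := by fun_prop
    have hclosed : ∀ k, IsClosed (C k) := fun k => by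
      have h := lowerSemicontinuous_worstCost hD hL hLc hX.isClosed
        (valueIter_regular hS hL hLconv hX hXc k).1
      exact hS.isClosed_inputSet.inter ((h.isClosed_preimage (valueLimit S L X x)).preimage hc)
    have hcomp : IsCompact (C 0) := by
      refine ((isCompact_setOf_next_mem hrank hX hX).image continuous_snd).of_isClosed_subset
        (hclosed 0) ?_
      rintro u ⟨-, hu⟩
      exact ⟨(x, u), ⟨hxX, effDom_valueIter_subset hD 0
        (next_mem_of_worstCost_ne_top (ne_top_of_le_ne_top htop hu) hd)⟩, rfl⟩
    have hne : ∀ k, (C k).Nonempty := fun k => by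
      obtain ⟨u, hu, hxu⟩ := (isMinMaxValue_bellman (L := L) hS hL hLc hX.isClosed
        (valueIter_regular hS hL hLconv hX hXc k).1 hX (effDom_valueIter_subset hD k) x).1
      exact ⟨u, hu, hxu.le.trans (valueIter_le_valueLimit (k + 1) x)⟩
    obtain ⟨u, hu⟩ := IsCompact.nonempty_iInter_of_sequence_nonempty_isCompact_isClosed C
      (fun k u hu => ⟨hu.1, (worstCost_mono (valueIter_monotone hD k.le_succ) x u).trans hu.2⟩)
      hne hcomp hclosed
    rw [Set.mem_iInter] at hu
    refine (bellman_le (hu 0).1).trans ?_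
    rw [worstCost_valueLimit]
    exact iSup_le fun k => (hu k).2
  · exact (valueIter_monotone hD k.le_succ x).trans
      (bellman_mono (valueIter_le_valueLimit k) x)

/-! ### Bounds on the limit from above -/

/-- The limit of value iteration lies below every solution of the robust control Lyapunov
inequality. -/
theorem valueLimit_le (hMX : effDom M ⊆ X) (hM : bellman S L X M ≤ M) : valueLimit S L X ≤ M := by
  have h : ∀ k, valueIter S L X k ≤ M := fun k => by
    induction k with
    | zero => exact convIndicator_le_iff.2 hMX
    | succ k ih => exact (bellman_mono ih).trans hM
  exact fun x => iSup_le fun k => h k x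

/-- The Lyapunov inequality carries the indicator of `𝕏`, the operator that of `X`; both vanish
where `M` is finite, and elsewhere the bound is trivial. -/
theorem IsRobustCLF.bellman_le (h : S.IsRobustCLF L M) (hMX : effDom M ⊆ X)
    (hMY : effDom M ⊆ S.stateSet) : bellman S L X M ≤ M := by
  intro x
  by_cases hx : x ∈ effDom M
  · obtain ⟨v, hv, hvx⟩ := h.robustCLI x
    rw [hv.eq_bellman, bellman, ← worstCost_congr (hMX hx) (hMY hx)] at hvx
    exact hvx
  · rw [not_lt_top_iff.1 (show ¬ M x < ⊤ from hx)]
    exact le_top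

/-- A robust contractive set provides a linear bound on value iteration. -/
theorem exists_valueLimit_le (hS : S.StandingAssumptions) {Xs : Set (Fin n → ℝ)} {c : ℝ}
    (hXs : S.IsRCI Xs) (hL : S.IsPosSemidefCost L Xs) (hc0 : 0 ≤ c) (hc1 : c < 1)
    (hX : S.IsRobustContractive c X Xs) (hsub : Xs ⊆ X) :
    ∃ K : ℝ, ∀ t : ℝ, 0 ≤ t → t ≤ 1 → ∀ y ∈ X, ∀ z ∈ Xs,
      valueLimit S L X (t • y + (1 - t) • z) ≤ ENNReal.ofReal (K * t) := by
  have hLc : Continuous fun p : (Fin n → ℝ) × (Fin m → ℝ) => L p.1 p.2 :=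
    hL.convex.locallyLipschitz.continuous
  obtain ⟨d₀, hd₀, hrank⟩ := hS.fullRank
  have hcombo : c • X + (1 - c) • Xs ⊆ X := by
    rintro _ ⟨_, ⟨a, ha, rfl⟩, _, ⟨b, hb, rfl⟩, rfl⟩
    exact hX.convex ha (hsub hb) hc0 (by linarith) (by ring)
  obtain ⟨C, hC⟩ := ((isCompact_setOf_next_mem hrank hX.isCompact hX.isCompact).image
    hLc).bddAbove
  have hctrl : ∀ y ∈ X, ∃ u ∈ S.inputSet, L y u ≤ max C 0 ∧
      ∀ d ∈ S.uncertainty, next d y u ∈ c • X + (1 - c) • Xs := by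
    intro y hy
    obtain ⟨u, hu, hnext⟩ := hX.contractive y hy
    exact ⟨u, hu, le_max_of_le_left (hC ⟨(y, u), ⟨hy, hcombo (hnext d₀ hd₀)⟩, rfl⟩), hnext⟩
  -- With `B = max C 0`, the constant `K = B / (1 - c)` sums the geometric series: `B + K * c = K`.
  have h1c : 0 < 1 - c := by linarith
  have hK : max C 0 + max C 0 / (1 - c) * c = max C 0 / (1 - c) := by
    field_simp
    ring
  have hK0 : 0 ≤ max C 0 / (1 - c) := div_nonneg (le_max_right _ _) h1c.le
  generalize max C 0 = B at hctrl hK hK0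
  generalize B / (1 - c) = K at hK hK0
  refine ⟨K, ?_⟩
  suffices h : ∀ k, ∀ t : ℝ, 0 ≤ t → t ≤ 1 → ∀ y ∈ X, ∀ z ∈ Xs,
      valueIter S L X k (t • y + (1 - t) • z) ≤ ENNReal.ofReal (K * t) from
    fun t ht0 ht1 y hy z hz => iSup_le fun k => h k t ht0 ht1 y hy z hz
  intro k
  induction k with
  | zero =>
    intro t ht0 ht1 y hy z hz
    have : t • y + (1 - t) • z ∈ X :=
      hX.convex hy (hsub hz) ht0 (by linarith) (by ring)
    simp [valueIter, convIndicator, this]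
  | succ k ih =>
    intro t ht0 ht1 y hy z hz
    obtain ⟨u, hu, hLu, hnu⟩ := hctrl y hy
    obtain ⟨v, hv, hLv, hnv⟩ := hL.zero_on z hz
    have h1t : 0 ≤ 1 - t := by linarith
    have hx : t • y + (1 - t) • z ∈ X := hX.convex hy (hsub hz) ht0 h1t (by ring)
    refine (bellman_le (hS.convex_inputSet hu hv ht0 h1t (by ring))).trans ?_
    refine iSup₂_le fun d hd => ?_
    rw [next_combo d y z u v (by ring)]
    obtain ⟨_, ⟨a, ha, rfl⟩, _, ⟨b, hb, rfl⟩, hab⟩ := hnu d hd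
    -- One step shrinks the weight on `X` from `t` to `t * c`; the remaining weight falls on a point
    -- of `Xs`, by convexity of `Xs`. The induction hypothesis then applies with `t * c`.
    have htc : t * c < 1 := by nlinarith
    have hpos : 0 < 1 - t * c := by linarith
    have hb' : (t * (1 - c) / (1 - t * c)) • b + ((1 - t) / (1 - t * c)) • next d z v ∈ Xs :=
      hXs.convex hb (hnv d hd) (div_nonneg (mul_nonneg ht0 h1c.le) hpos.le)
        (div_nonneg h1t hpos.le) (by field_simp; ring)
    have hnext : t • next d y u + (1 - t) • next d z v = (t * c) • a + (1 - t * c) •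
        ((t * (1 - c) / (1 - t * c)) • b + ((1 - t) / (1 - t * c)) • next d z v) := by
      rw [← hab]
      simp only [smul_add, smul_smul]
      rw [mul_div_cancel₀ _ hpos.ne', mul_div_cancel₀ _ hpos.ne', add_assoc]
    have hLle : L (t • y + (1 - t) • z) (t • u + (1 - t) • v) ≤ t * B := by
      have h := hL.convex.2 (Set.mem_univ (y, u)) (Set.mem_univ (z, v)) ht0 h1t (by ring)
      simp only [Prod.smul_mk, Prod.mk_add_mk, smul_eq_mul, hLv, mul_zero, add_zero] at h
      exact h.trans (mul_le_mul_of_nonneg_left hLu ht0)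
    have hB : 0 ≤ t * B := (hL.nonneg _ _).trans hLle
    rw [hnext, convIndicator, if_pos hx, add_zero]
    calc _ ≤ ENNReal.ofReal (t * B) + ENNReal.ofReal (K * (t * c)) :=
          add_le_add (ENNReal.ofReal_le_ofReal hLle)
            (ih (t * c) (mul_nonneg ht0 hc0) htc.le a ha _ hb')
      _ = ENNReal.ofReal (K * t) := by
          rw [← ENNReal.ofReal_add hB (mul_nonneg hK0 (mul_nonneg ht0 hc0))]
          congr 1
          linear_combination t * hK

end UncertainSystem

/-! ### Existence, uniqueness and the HJB equation -/

open UncertainSystem in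
theorem mainTheorem4 {n m : ℕ} (S : UncertainSystem n m) (hS : S.StandingAssumptions)
    (L : (Fin n → ℝ) → (Fin m → ℝ) → ℝ) (Xs X : Set (Fin n → ℝ)) (c : ℝ)
    (hXs : S.IsRCI Xs) (hL : S.IsPosSemidefCost L Xs)
    (hc0 : 0 ≤ c) (hc1 : c < 1) (hX : S.IsRobustContractive c X Xs) (hsub : Xs ⊆ X)
    (μ : Measure (Fin n → ℝ)) [IsProbabilityMeasure μ] (hμ : μ.support = X) :
    ∃ Mstar : (Fin n → ℝ) → ℝ≥0∞,
      S.IsMinimizer L X μ Mstar ∧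
      (∀ M, S.IsMinimizer L X μ M → M = Mstar) ∧
      ∀ x ∈ X, S.IsMinMaxValue L X Mstar x (Mstar x) := by
  have hLc : Continuous fun p : (Fin n → ℝ) × (Fin m → ℝ) => L p.1 p.2 :=
    hL.convex.locallyLipschitz.continuous
  have hXne : X.Nonempty := hμ ▸ Measure.nonempty_support (IsProbabilityMeasure.ne_zero μ)
  obtain ⟨d₀, hd₀⟩ := hS.nonempty_uncertainty
  obtain ⟨z, hz⟩ : Xs.Nonempty := by
    obtain ⟨y, hy⟩ := hXne
    obtain ⟨u, -, hu⟩ := hX.contractive y hy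
    obtain ⟨_, -, _, ⟨b, hb, -⟩, -⟩ := hu d₀ hd₀
    exact ⟨b, hb⟩
  set V := valueLimit S L X with hV
  have hVl : LowerSemicontinuous V :=
    lowerSemicontinuous_valueLimit hS hL.nonneg hL.convex hX.isCompact hX.convex
  have hVc : Convex ℝ (epigraph V) :=
    convex_epigraph_valueLimit hS hL.nonneg hL.convex hX.isCompact hX.convex
  have hVb : bellman S L X V = V :=
    bellman_valueLimit hS hL.nonneg hL.convex hX.isCompact hX.convex
  obtain ⟨K, hK⟩ := exists_valueLimit_le hS hXs hL hc0 hc1 hX hsub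
  -- The linear bound at `t = 1` gives boundedness on `X`; at `t = 0` it gives a zero in `Xs`.
  have hVK : ∀ x ∈ X, V x ≤ ENNReal.ofReal K := fun x hx => by
    simpa using hK 1 zero_le_one le_rfl x hx z hz
  have hVz : V z = 0 := by simpa using hK 0 le_rfl zero_le_one z (hsub hz) z hz
  have hVd : effDom V = X :=
    effDom_valueLimit_subset.antisymm fun x hx => (hVK x hx).trans_lt ENNReal.ofReal_lt_top
  have hmin : ∀ x, S.IsMinMaxValue L X V x (V x) := fun x => by
    have h := isMinMaxValue_bellman (L := L) hS hL.nonneg hLc hX.isCompact.isClosed hVl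
      hX.isCompact hVd.subset x
    rwa [hVb] at h
  have hclf : V ∈ robustCLFs S L X := by
    refine ⟨⟨⟨hVd ▸ hXne, hVd ▸ hX.isCompact, isClosed_epigraph_iff.2 hVl, hVc⟩,
      ⟨z, hX.subset (hsub hz), hVz⟩, fun x => ?_⟩, hVd⟩
    by_cases hx : x ∈ X
    · refine ⟨V x, ?_, le_rfl⟩
      have h := hmin x
      rwa [IsMinMaxValue, worstCost_congr hx (hX.subset hx)] at h
    · refine ⟨_, isMinMaxValue_bellman hS hL.nonneg hLc hS.isClosed_stateSet hVl hX.isCompact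
        hVd.subset x, ?_⟩
      rw [not_lt_top_iff.1 fun h : V x < ⊤ => hx (hVd ▸ h)]
      exact le_top
  have hle : ∀ M ∈ robustCLFs S L X, V ≤ M := fun M hM =>
    valueLimit_le hM.2.subset (hM.1.bellman_le hM.2.subset (hM.2.subset.trans hX.subset))
  refine ⟨V, ⟨hclf, fun M hM => lintegral_mono (hle M hM)⟩, fun M hM => ?_, fun x _ => hmin x⟩
  have hMl : LowerSemicontinuous M :=
    isClosed_epigraph_iff.1 hM.1.1.properCompactConvex.isClosed_epi
  have hXae : ∀ᵐ x ∂μ, x ∈ X := hμ ▸ Measure.support_mem_ae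
  -- Finiteness is what lets `V ≤ M` and the reverse inequality of integrals force equality almost
  -- everywhere.
  have hfin : ∫⁻ x in X, V x ∂μ ≠ ⊤ := by
    refine ne_top_of_le_ne_top (b := ∫⁻ _ in X, ENNReal.ofReal K ∂μ) ?_
      (setLIntegral_mono measurable_const hVK)
    rw [setLIntegral_const]
    exact ENNReal.mul_ne_top ENNReal.ofReal_ne_top (measure_ne_top μ X)
  have hae := ae_eq_of_ae_le_of_lintegral_le (Eventually.of_forall (hle M hM.1)) hfin
    hMl.measurable.aemeasurable (hM.2 V hclf)
  rw [Measure.restrict_eq_self_of_ae_mem hXae] at hae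
  refine eq_of_eqOn_dense (E := {x | x ∈ X ∧ M x = V x}) hX.convex hM.1.2 hVd
    hM.1.1.properCompactConvex.convex_epi hVc hMl hVl (fun x hx => hx.1) (fun x hx => ?_)
    fun x hx => hx.2
  -- Every neighbourhood of a support point has positive measure, so it meets the full-measure set
  -- of agreement.
  rw [mem_closure_iff_nhds]
  intro U hU
  have hpos : 0 < μ U := Measure.mem_support_iff_forall x |>.1 (hμ ▸ hx) U hU
  obtain ⟨y, hyU, hy⟩ := Measure.exists_mem_of_measure_ne_zero_of_ae hpos.ne'
    (ae_restrict_of_ae (hXae.and hae))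
  exact ⟨y, hyU, hy.1, hy.2.symm⟩
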